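/- Let $\mathbb{K}$ be $\mathbb{R}$ or $\mathbb{C}$. A pattern of homogeneity is an affine hyperplane $\Lambda\subset\mathbb{R}^d$ that intersects every open positive coordinate semi-axis $\{te_i : t>0\}$, $i=1,\dots,d$. A constant-coefficient differential operator $T=\sum_m c_m\partial^m$ (a finite sum over multi-indices $m\in\mathbb{Z}_{\ge 0}^d$, with $c_m\in\mathbb{K}$) is called $\Lambda$-homogeneous if every $m$ with $c_m\neq 0$, regarded as a point of $\mathbb{R}^d$, lies on $\Lambda$. Let $\Lambda$ be a pattern of homogeneity in $\mathbb{R}^d$, let $\ell\ge 1$, and let $T_1,\dots,T_\ell$ be $\Lambda$-homogeneous differential operators with constant coefficients in $\mathbb{K}$. Suppose that the degrees $|m|=m_1+\dots+m_d$ of all the monomials $\partial^m$ that occur with a non-zero coefficient in at least one of the $T_j$ have one and the same parity. If there is a constant $C<\infty$ such that $$\|T_1 f\|_{L^1(\mathbb{R}^d)}\le C\sum_{j=2}^{\ell}\|T_j f\|_{L^1(\mathbb{R}^d)}$$ for every compactly supported $C^\infty$ function $f:\mathbb{R}^d\to\mathbb{K}$, then $T_1$ is a linear combination of $T_2,\dots,T_\ell$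 with coefficients in $\mathbb{K}$. (If $\ell=1$, the sum is $0$ and the conclusion is $T_1=0$.) -/

import Mathlib

open MeasureTheory
open scoped ContDiff NNReal

noncomputable section

namespace Ornstein

/-- An affine hyperplane of `ℝ^d` that intersects all the (open) positive coordinate semi-axes. -/
structure IsPatternOfHomogeneity {d : ℕ} (Λ : AffineSubspace ℝ (Fin d → ℝ)) : Prop where
  hyperplane : Module.finrank ℝ Λ.direction + 1 = d
  meets_semiaxis : ∀ i : Fin d, ∃ t : ℝ, 0 < t ∧ (Pi.single i t : Fin d → ℝ) ∈ Λ

/-- The Newton diagram of a differential polynomial `P(∂)`: the exponents `m`, as points of `ℝ^d`,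
of the monomials that occur in `P` with a non-zero coefficient. -/
def newtonDiagram {𝕜 : Type*} [RCLike 𝕜] {d : ℕ} (P : MvPolynomial (Fin d) 𝕜) :
    Set (Fin d → ℝ) :=
  {p | ∃ m ∈ P.support, p = fun i => (m i : ℝ)}

/-- `P(∂)` is `Λ`-homogeneous: its Newton diagram lies on `Λ`. -/
def IsLambdaHomogeneous {𝕜 : Type*} [RCLike 𝕜] {d : ℕ}
    (Λ : AffineSubspace ℝ (Fin d → ℝ)) (P : MvPolynomial (Fin d) 𝕜) : Prop :=
  newtonDiagram P ⊆ (Λ : Set (Fin d → ℝ))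

/-- The partial derivative `∂_i f`. -/
def partialDeriv {𝕜 : Type*} [RCLike 𝕜] {d : ℕ} (i : Fin d) (f : (Fin d → ℝ) → 𝕜) :
    (Fin d → ℝ) → 𝕜 :=
  fun x => fderiv ℝ f x (Pi.single i 1)

/-- The iterated partial derivative `∂^m f = ∂_1^{m_1} ⋯ ∂_d^{m_d} f`. -/
def multiDeriv {𝕜 : Type*} [RCLike 𝕜] {d : ℕ} (m : Fin d →₀ ℕ) (f : (Fin d → ℝ) → 𝕜) :
    (Fin d → ℝ) → 𝕜 :=
  (List.finRange d).foldr (fun i g => (partialDeriv i)^[m i] g) f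

/-- The constant-coefficient differential operator `P(∂) = ∑ c_m ∂^m` applied to `f`,
where `P = ∑ c_m X^m`. -/
def diffOp {𝕜 : Type*} [RCLike 𝕜] {d : ℕ} (P : MvPolynomial (Fin d) 𝕜)
    (f : (Fin d → ℝ) → 𝕜) : (Fin d → ℝ) → 𝕜 :=
  fun x => ∑ m ∈ P.support, P.coeff m * multiDeriv m f x

end Ornstein

end

/-!
The proof is by convexity. Let `S` be the set of multi-indices that occur in the operators, and
write `jet f x = (∂^m f x)_{m ∈ S}`. The inequality says that the positively homogeneous function
`V e = C ∑_{j ≥ 2} |T_j e| - |T_1 e|` of the jet has a nonnegative integral along the jet of every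
test function. The claim is that then `V e + V (-e) ≥ 0` for all `e`. So `T_1 e = 0` as soon as
`T_j e = 0` for all `j ≥ 2`, and linear algebra gives that `T_1` is a combination of the others.

*Waves.* If `Λ = {∑ p_i γ_i = 1}`, the function `exp (-τ) χ(x) cos (ω · x + θ)` with frequency
`ω_i = exp (γ_i τ) ξ_i` has, up to an error that tends to `0` as `τ → ∞`, the jet
`χ(x) cos (ω · x + θ') a_ξ`, where `a_ξ = (± ξ^m)_m`. The common parity of the degrees is
what makes all coordinates oscillate in phase. Adding such a wave to a test function and averaging
over `θ` shows that the inequality `∫ u (jet f) ≥ 0` passes from `u` to the function obtained by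
replacing `u e`, where this is smaller, by the mean of `u (e + cos θ • a_ξ)` over `θ`
(`IsNonnegOnJets.waveStep`). The average over the phase is exact for every frequency, so no
equidistribution argument is needed.

*Envelope.* The infimum `B ≤ V` of all functions obtained by repeating this step satisfies the
sub-mean value inequality along every direction `a_ξ`. Hence it is convex in these directions
(`convexOn_of_le_circleMean`), and it is again Lipschitz and positively homogeneous.

*Homogeneous directionally convex functions.* For such a `B` and a direction `v` of convexity,
`B (y + t v) - t B v` decreases in `t`. Its limit as `t → ∞` is a minorant of `B` of the same kind
that is affine along `v`. Doing this for finitely many directions whose span contains `e` gives a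
minorant that is linear along `e`, so that `B e + B (-e) ≥ 0`
(`IsHomogeneousConvexAlong.add_neg_nonneg`). The directions `a_ξ` and their multiples span the
whole space since distinct monomials are linearly independent.
-/

namespace Ornstein

open Filter Topology Set

/-! ### Convexity from mean values over the circle -/

section Convexity

theorem integral_cos_zero_two_pi : ∫ θ in (0 : ℝ)..2 * Real.pi, Real.cos θ = 0 := by
  simp

/-- A continuous function that is bounded by its means over the projections of all circles is
convex: otherwise its difference with a chord has an interior maximum. -/
theorem convexOn_of_le_circleMean {φ : ℝ → ℝ} (hφ : Continuous φ)
    (h : ∀ x s : ℝ, φ x ≤ (2 * Real.pi)⁻¹ * ∫ θ in (0 : ℝ)..2 * Real.pi, φ (x + Real.cos θ * s)) :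
    ConvexOn ℝ univ φ := by
  have hpi : 0 < 2 * Real.pi := by positivity
  refine LinearOrder.convexOn_of_lt convex_univ fun x _ y _ hxy a b ha hb hab => ?_
  by_contra! hlt
  set k : ℝ := (φ y - φ x) / (y - x) with hk
  have hyx : 0 < y - x := sub_pos.2 hxy
  set ψ : ℝ → ℝ := fun t => φ t - (φ x + k * (t - x)) with hψ
  have hψc : Continuous ψ := by fun_prop
  have hψx : ψ x = 0 := by simp [hψ]
  have hψy : ψ y = 0 := by simp only [hψ, hk]; field_simp; ring
  have hmid : 0 < ψ (a • x + b • y) := by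
    have hb' : a = 1 - b := by linarith
    have : ψ (a • x + b • y) = φ (a • x + b • y) - (a • φ x + b • φ y) := by
      simp only [hψ, hk, smul_eq_mul, hb']; field_simp; ring
    rw [this]; linarith
  have hψm : ∀ t s : ℝ, ψ t ≤
      (2 * Real.pi)⁻¹ * ∫ θ in (0 : ℝ)..2 * Real.pi, ψ (t + Real.cos θ * s) := by
    intro t s
    have e1 : ∫ θ in (0 : ℝ)..2 * Real.pi, ψ (t + Real.cos θ * s) =
        (∫ θ in (0 : ℝ)..2 * Real.pi, φ (t + Real.cos θ * s)) -
          (2 * Real.pi) * (φ x + k * (t - x)) := by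
      have : ∀ θ, ψ (t + Real.cos θ * s) = φ (t + Real.cos θ * s) -
          ((φ x + k * (t - x)) + Real.cos θ * (k * s)) := by intro θ; simp only [hψ]; ring
      simp_rw [this]
      rw [intervalIntegral.integral_sub, intervalIntegral.integral_add,
        intervalIntegral.integral_mul_const, integral_cos_zero_two_pi]
      · simp only [intervalIntegral.integral_const, zero_mul, smul_eq_mul]; ring
      all_goals exact Continuous.intervalIntegrable (by fun_prop) _ _
    rw [e1, mul_sub, ← mul_assoc, inv_mul_cancel₀ hpi.ne', one_mul]
    have := h t s
    simp only [hψ]; linarith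
  obtain ⟨t₁, ht₁, hmax⟩ := isCompact_Icc.exists_isMaxOn (nonempty_Icc.2 hxy.le) hψc.continuousOn
  have hMpos : 0 < ψ t₁ := by
    refine hmid.trans_le (hmax ?_)
    exact convex_Icc x y (left_mem_Icc.2 hxy.le) (right_mem_Icc.2 hxy.le) ha.le hb.le hab
  set Z : Set ℝ := Icc x y ∩ ψ ⁻¹' {ψ t₁} with hZ
  have hZc : IsCompact Z := isCompact_Icc.inter_right (isClosed_singleton.preimage hψc)
  -- the leftmost maximum point violates the mean value inequality
  obtain ⟨t₀, ⟨ht₀, ht₀M⟩, hleast⟩ := hZc.exists_isLeast ⟨t₁, ht₁, rfl⟩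
  simp only [mem_preimage, mem_singleton_iff] at ht₀M
  have hx0 : x < t₀ := lt_of_le_of_ne ht₀.1 (by rintro rfl; linarith)
  have hy0 : t₀ < y := lt_of_le_of_ne ht₀.2 (by rintro rfl; linarith)
  obtain ⟨s, hs, hsx, hsy⟩ : ∃ s > 0, x ≤ t₀ - s ∧ t₀ + s ≤ y :=
    ⟨min (t₀ - x) (y - t₀), lt_min (by linarith) (by linarith),
      by linarith [min_le_left (t₀ - x) (y - t₀)], by linarith [min_le_right (t₀ - x) (y - t₀)]⟩
  have hin : ∀ θ, t₀ + Real.cos θ * s ∈ Icc x y := fun θ =>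
    ⟨by nlinarith [Real.neg_one_le_cos θ], by nlinarith [Real.cos_le_one θ]⟩
  have hstrict : ∫ θ in (0 : ℝ)..2 * Real.pi, ψ (t₀ + Real.cos θ * s) <
      ∫ _ in (0 : ℝ)..2 * Real.pi, ψ t₁ := by
    refine intervalIntegral.integral_lt_integral_of_continuousOn_of_le_of_exists_lt hpi
      (by fun_prop) (by fun_prop) (fun θ _ => hmax (hin θ)) ⟨Real.pi, ⟨?_, ?_⟩, ?_⟩
    · positivity
    · linarith [Real.pi_pos]
    · refine lt_of_le_of_ne (hmax (hin _)) fun heq => ?_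
      have := hleast ⟨hin Real.pi, heq⟩
      simp only [Real.cos_pi] at this
      linarith
  have := hψm t₀ s
  rw [intervalIntegral.integral_const, smul_eq_mul, sub_zero] at hstrict
  rw [ht₀M] at this
  have h3 := mul_lt_mul_of_pos_left hstrict (inv_pos.2 hpi)
  rw [← mul_assoc, inv_mul_cancel₀ hpi.ne', one_mul] at h3
  linarith

end Convexity

/-! ### Positively homogeneous functions that are convex in given directions -/

section HomogeneousMinorant

variable {E : Type*} [NormedAddCommGroup E] [NormedSpace ℝ E]

/-- `f` is `L`-Lipschitz, positively
homogeneous of degree one, and convex along every line whose direction lies in `D`. -/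
structure IsHomogeneousConvexAlong (L : ℝ≥0) (D : Set E) (f : E → ℝ) : Prop where
  lipschitz : LipschitzWith L f
  map_smul : ∀ t : ℝ, 0 < t → ∀ e, f (t • e) = t * f e
  convex : ∀ e, ∀ v ∈ D, ConvexOn ℝ univ fun t : ℝ => f (e + t • v)

/-- `f` is affine on every line with direction `w`, with the slope `f w`. -/
def IsAffineAlong (f : E → ℝ) (w : E) : Prop :=
  ∀ (y : E) (r : ℝ), f (y + r • w) = f y + r * f w

theorem IsHomogeneousConvexAlong.map_zero {L : ℝ≥0} {D : Set E} {f : E → ℝ}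
    (hf : IsHomogeneousConvexAlong L D f) : f 0 = 0 := by
  have := hf.map_smul 2 two_pos 0
  rw [smul_zero] at this; linarith

theorem IsHomogeneousConvexAlong.antitone {L : ℝ≥0} {D : Set E} {f : E → ℝ}
    (hf : IsHomogeneousConvexAlong L D f) {v : E} (hv : v ∈ D) (y : E) :
    Antitone fun t : ℝ => f (y + t • v) - t * f v := by
  intro s t hst
  rcases hst.eq_or_lt with rfl | hst
  · exact le_rfl
  simp only
  -- The slope on `[s, t]` is at most the slope on `[t, r]`, and the latter tends to `f v`
  -- as `r → ∞`, since `f (y + r • v)` differs from `r * f v` by at most `L * ‖y‖`.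
  have hlim : ∀ r : ℝ, t < r → (f (y + t • v) - f (y + s • v)) / (t - s) ≤
      (r * f v + L * ‖y‖ - f (y + t • v)) / (r - t) ∨ r ≤ 0 := by
    intro r hr
    rcases le_or_gt r 0 with h0 | h0
    · exact Or.inr h0
    left
    refine ((hf.convex y v hv).slope_mono_adjacent (mem_univ s) (mem_univ r) hst hr).trans ?_
    have h1 : f (y + r • v) - f (r • v) ≤ L * ‖y‖ := by
      have := hf.lipschitz.dist_le_mul (y + r • v) (r • v)
      rw [Real.dist_eq, dist_eq_norm, add_sub_cancel_right] at this
      exact (le_abs_self _).trans this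
    rw [hf.map_smul r h0] at h1
    have : 0 < r - t := sub_pos.2 hr
    gcongr
    linarith
  have hts : 0 < t - s := sub_pos.2 hst
  have hslope : (f (y + t • v) - f (y + s • v)) / (t - s) ≤ f v := by
    have htend : Tendsto (fun r : ℝ => (r * f v + L * ‖y‖ - f (y + t • v)) / (r - t)) atTop
        (𝓝 (f v)) := by
      have : Tendsto (fun r : ℝ => f v + (t * f v + L * ‖y‖ - f (y + t • v)) / (r - t)) atTop
          (𝓝 (f v + 0)) := by
        refine tendsto_const_nhds.add (Tendsto.const_div_atTop ?_ _)
        exact tendsto_atTop_add_const_right _ _ tendsto_id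
      rw [add_zero] at this
      refine this.congr' ?_
      filter_upwards [eventually_gt_atTop t] with r hr
      have : r - t ≠ 0 := (sub_pos.2 hr).ne'
      field_simp
      ring
    refine ge_of_tendsto htend ?_
    filter_upwards [eventually_gt_atTop t, eventually_gt_atTop 0] with r hr h0
    exact (hlim r hr).resolve_right (not_le.2 h0)
  rw [div_le_iff₀ hts] at hslope
  linarith

/-- The minorant is the limit, as `t → ∞`, of the decreasing functions
`y ↦ f (y + t • v) - t * f v`. -/
theorem IsHomogeneousConvexAlong.exists_le_isAffineAlong {L : ℝ≥0} {D : Set E} {f : E → ℝ}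
    (hf : IsHomogeneousConvexAlong L D f) {v : E} (hv : v ∈ D) :
    ∃ g, IsHomogeneousConvexAlong L D g ∧ (∀ e, g e ≤ f e) ∧ IsAffineAlong g v ∧
      ∀ w, IsAffineAlong f w → IsAffineAlong g w := by
  have hbdd : ∀ y, BddBelow (range fun t : ℝ => f (y + t • v) - t * f v) := by
    intro y
    refine ⟨-(L * ‖y‖), ?_⟩
    rintro _ ⟨t, rfl⟩
    refine le_trans ?_ (hf.antitone hv y (le_max_left t 1))
    simp only
    set r := max t 1
    have hr : 0 < r := lt_of_lt_of_le one_pos (le_max_right _ _)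
    have := hf.lipschitz.dist_le_mul (y + r • v) (r • v)
    rw [Real.dist_eq, dist_eq_norm, add_sub_cancel_right, hf.map_smul r hr] at this
    linarith [neg_abs_le (f (y + r • v) - r * f v)]
  set g : E → ℝ := fun y => ⨅ t : ℝ, (f (y + t • v) - t * f v) with hg
  have hlim : ∀ y, Tendsto (fun t : ℝ => f (y + t • v) - t * f v) atTop (𝓝 (g y)) := fun y =>
    tendsto_atTop_ciInf (hf.antitone hv y) (hbdd y)
  have hgf : ∀ e, g e ≤ f e := fun e => by
    simpa using ciInf_le (hbdd e) 0
  have haff : ∀ w, IsAffineAlong f w → IsAffineAlong g w ∧ g w = f w := by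
    intro w hw
    have h1 : ∀ y (r : ℝ), g (y + r • w) = g y + r * f w := by
      intro y r
      refine tendsto_nhds_unique (hlim _) (((hlim y).add_const (r * f w)).congr fun t => ?_)
      rw [add_right_comm, hw]; ring
    have h0 : g 0 = 0 := by
      refine tendsto_nhds_unique (hlim 0) (tendsto_const_nhds.congr' ?_)
      filter_upwards [eventually_gt_atTop 0] with t ht
      rw [zero_add, hf.map_smul t ht, sub_self]
    have h2 : g w = f w := by simpa [h0] using h1 0 1
    exact ⟨fun y r => by rw [h1, h2], h2⟩
  refine ⟨g, ⟨?_, ?_, ?_⟩, hgf, ?_, fun w hw => (haff w hw).1⟩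
  · refine LipschitzWith.of_le_add_mul L fun x y => ?_
    refine le_of_tendsto_of_tendsto' (hlim x) ((hlim y).add_const _) fun t => ?_
    have := hf.lipschitz.le_add_mul (x + t • v) (y + t • v)
    rw [dist_add_right] at this
    linarith
  · intro s hs e
    have h1 := (hlim e).const_mul s
    have h2 : Tendsto (fun t : ℝ => f (s • e + (s * t) • v) - (s * t) * f v) atTop
        (𝓝 (g (s • e))) :=
      (hlim (s • e)).comp (tendsto_id.const_mul_atTop hs)
    refine tendsto_nhds_unique h2 (h1.congr fun t => ?_)
    rw [mul_smul, ← smul_add, hf.map_smul s hs]; ring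
  · intro e w hw
    refine ⟨convex_univ, fun x _ y _ a b ha hb hab => ?_⟩
    refine le_of_tendsto_of_tendsto' (hlim _) (((hlim (e + x • w)).const_smul a).add
      ((hlim (e + y • w)).const_smul b)) fun t => ?_
    have := (hf.convex (e + t • v) w hw).2 (mem_univ x) (mem_univ y) ha hb hab
    simp only [smul_eq_mul] at this ⊢
    rw [add_right_comm e (_ • w), add_right_comm e (x • w), add_right_comm e (y • w)]
    have hb' : a = 1 - b := by linarith
    subst hb'
    linarith
  · have hv0 : ∀ y (r : ℝ), g (y + r • v) = g y + r * f v := by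
      intro y r
      have h2 : Tendsto (fun t : ℝ => f (y + (r + t) • v) - (r + t) * f v) atTop (𝓝 (g y)) :=
        (hlim y).comp (tendsto_atTop_add_const_left _ r tendsto_id)
      refine tendsto_nhds_unique (hlim _) ((h2.add_const (r * f v)).congr fun t => ?_)
      rw [add_smul, ← add_assoc]; ring
    have h0 : g 0 = 0 := by
      refine tendsto_nhds_unique (hlim 0) (tendsto_const_nhds.congr' ?_)
      filter_upwards [eventually_gt_atTop 0] with t ht
      rw [zero_add, hf.map_smul t ht, sub_self]
    have h2 : g v = f v := by simpa [h0] using hv0 0 1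
    exact fun y r => by rw [hv0, h2]

theorem IsHomogeneousConvexAlong.exists_le_forall_isAffineAlong {L : ℝ≥0} {D : Set E}
    {f : E → ℝ} (hf : IsHomogeneousConvexAlong L D f) (s : Finset E) (hs : ↑s ⊆ D) :
    ∃ g, IsHomogeneousConvexAlong L D g ∧ (∀ e, g e ≤ f e) ∧ ∀ w ∈ s, IsAffineAlong g w := by
  classical
  induction s using Finset.induction_on with
  | empty => exact ⟨f, hf, fun _ => le_rfl, by simp⟩
  | insert v s _ ih =>
    rw [Finset.coe_insert, insert_subset_iff] at hs
    obtain ⟨g, hg, hgf, hgs⟩ := ih hs.2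
    obtain ⟨k, hk, hkg, hkv, hkw⟩ := hg.exists_le_isAffineAlong hs.1
    refine ⟨k, hk, fun e => (hkg e).trans (hgf e), fun w hw => ?_⟩
    rcases Finset.mem_insert.1 hw with rfl | hw
    · exact hkv
    · exact hkw w (hgs w hw)

/-- Convexity at the origin along lines whose direction is only in the span of `D`: the vectors
along which a minorant is affine form a subspace. -/
theorem IsHomogeneousConvexAlong.add_neg_nonneg {L : ℝ≥0} {D : Set E} {f : E → ℝ}
    (hf : IsHomogeneousConvexAlong L D f) {e : E} (he : e ∈ Submodule.span ℝ D) :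
    0 ≤ f e + f (-e) := by
  obtain ⟨s, hsD, hes⟩ := Submodule.mem_span_finite_of_mem_span he
  obtain ⟨g, hg, hgf, hgs⟩ := hf.exists_le_forall_isAffineAlong s hsD
  have hge : IsAffineAlong g e := by
    clear he
    induction hes using Submodule.span_induction with
    | mem x hx => exact hgs x hx
    | zero => intro y r; simp [hg.map_zero]
    | add x z _ _ hx hz =>
      have hxz : g (x + z) = g x + g z := by simpa using hz x 1
      intro y r
      rw [smul_add, ← add_assoc, hz, hx, hxz]; ring
    | smul a x _ hx =>
      have : g (a • x) = a * g x := by simpa [hg.map_zero] using hx 0 a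
      intro y r
      rw [smul_smul, hx, this]; ring
  have h1 := hge e (-1)
  rw [neg_one_smul, add_neg_cancel, hg.map_zero] at h1
  have h2 := hge 0 (-1)
  rw [neg_one_smul, zero_add, hg.map_zero] at h2
  linarith [hgf e, hgf (-e)]

end HomogeneousMinorant

/-! ### The envelope for mean values along waves -/

section Envelope

variable {E : Type*} [NormedAddCommGroup E] [NormedSpace ℝ E]

/-- The mean of `u` over the values `e + cos θ • a`, `θ` uniformly distributed. -/
noncomputable def waveMean (u : E → ℝ) (a e : E) : ℝ :=
  (2 * Real.pi)⁻¹ * ∫ θ in (0 : ℝ)..2 * Real.pi, u (e + Real.cos θ • a)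

/-- `u`, lowered to its mean `waveMean u a` at the points where the latter is smaller. -/
noncomputable def waveStep (a : E) (u : E → ℝ) (e : E) : ℝ := min (u e) (waveMean u a e)

/-- The functions obtained from `V` by finitely many steps with directions in `D`. -/
inductive WaveIterate (D : Set E) (V : E → ℝ) : (E → ℝ) → Prop
  | base : WaveIterate D V V
  | step {u : E → ℝ} {a : E} (ha : a ∈ D) (hu : WaveIterate D V u) :
      WaveIterate D V (waveStep a u)

/-- The envelope of `V`: the infimum of all functions obtained from it. -/
noncomputable def waveEnvelope (D : Set E) (V : E → ℝ) (e : E) : ℝ :=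
  ⨅ u : {u : E → ℝ // WaveIterate D V u}, u.1 e

theorem waveMean_mono {u w : E → ℝ} (hu : Continuous u) (hw : Continuous w) (h : ∀ e, u e ≤ w e)
    (a e : E) : waveMean u a e ≤ waveMean w a e := by
  refine mul_le_mul_of_nonneg_left ?_ (by positivity)
  exact intervalIntegral.integral_mono_on (by positivity)
    (Continuous.intervalIntegrable (by fun_prop) _ _)
    (Continuous.intervalIntegrable (by fun_prop) _ _) fun _ _ => h _

theorem waveMean_const (c : ℝ) (a e : E) : waveMean (fun _ => c) a e = c := by
  have : (2 * Real.pi) ≠ 0 := by positivity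
  simp only [waveMean, intervalIntegral.integral_const, sub_zero, smul_eq_mul]
  rw [← mul_assoc, inv_mul_cancel₀ this, one_mul]

theorem waveMean_zero (u : E → ℝ) (e : E) : waveMean u 0 e = u e := by
  simpa [waveMean] using waveMean_const (u e) 0 e

theorem waveMean_add_const {u : E → ℝ} (hu : Continuous u) (c : ℝ) (a e : E) :
    waveMean (fun x => u x + c) a e = waveMean u a e + c := by
  have h := waveMean_const c a e
  simp only [waveMean] at h ⊢
  rw [intervalIntegral.integral_add (Continuous.intervalIntegrable (by fun_prop) _ _)
    (by simp), mul_add, h]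

theorem waveMean_le_add {u : E → ℝ} {L : ℝ≥0} (hu : LipschitzWith L u) (a b e f : E) :
    waveMean u a e ≤ waveMean u b f + L * (‖e - f‖ + ‖a - b‖) := by
  have hc := hu.continuous
  have hpi : (2 * Real.pi) ≠ 0 := by positivity
  have key : ∫ θ in (0 : ℝ)..2 * Real.pi, u (e + Real.cos θ • a) ≤
      ∫ θ in (0 : ℝ)..2 * Real.pi, (u (f + Real.cos θ • b) + L * (‖e - f‖ + ‖a - b‖)) := by
    refine intervalIntegral.integral_mono_on (by positivity)
      (Continuous.intervalIntegrable (by fun_prop) _ _)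
      (Continuous.intervalIntegrable (by fun_prop) _ _) fun θ _ => ?_
    refine (hu.le_add_mul _ (f + Real.cos θ • b)).trans ?_
    gcongr
    rw [dist_eq_norm, add_sub_add_comm, ← smul_sub]
    refine (norm_add_le _ _).trans ?_
    gcongr
    rw [norm_smul]
    exact mul_le_of_le_one_left (norm_nonneg _) (Real.abs_cos_le_one θ)
  rw [intervalIntegral.integral_add (Continuous.intervalIntegrable (by fun_prop) _ _) (by simp),
    intervalIntegral.integral_const, sub_zero, smul_eq_mul] at key
  calc waveMean u a e ≤ (2 * Real.pi)⁻¹ * _ := mul_le_mul_of_nonneg_left key (by positivity)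
    _ = _ := by rw [mul_add, ← mul_assoc, inv_mul_cancel₀ hpi, one_mul]; rfl

theorem lipschitzWith_waveMean {u : E → ℝ} {L : ℝ≥0} (hu : LipschitzWith L u) (a : E) :
    LipschitzWith L (waveMean u a) :=
  LipschitzWith.of_le_add_mul L fun e f => by
    simpa [dist_eq_norm] using waveMean_le_add hu a a e f

theorem waveStep_le (a : E) (u : E → ℝ) (e : E) : waveStep a u e ≤ u e := min_le_left _ _

theorem waveStep_mono {u w : E → ℝ} (hu : Continuous u) (hw : Continuous w) (h : ∀ e, u e ≤ w e)
    (a e : E) : waveStep a u e ≤ waveStep a w e :=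
  min_le_min (h e) (waveMean_mono hu hw h a e)

theorem lipschitzWith_waveStep {u : E → ℝ} {L : ℝ≥0} (hu : LipschitzWith L u) (a : E) :
    LipschitzWith L (waveStep a u) := by
  simpa using! hu.min (lipschitzWith_waveMean hu a)

theorem WaveIterate.lipschitz {D : Set E} {V : E → ℝ} {L : ℝ≥0} (hV : LipschitzWith L V)
    {u : E → ℝ} (hu : WaveIterate D V u) : LipschitzWith L u := by
  induction hu with
  | base => exact hV
  | step _ _ ih => exact lipschitzWith_waveStep ih _

theorem WaveIterate.le {D : Set E} {V : E → ℝ} {u : E → ℝ} (hu : WaveIterate D V u) (e : E) :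
    u e ≤ V e := by
  induction hu with
  | base => exact le_rfl
  | step _ _ ih => exact (waveStep_le _ _ _).trans ih

/-- The functions obtained from `V` are directed downwards. -/
theorem WaveIterate.exists_le_le {D : Set E} {V : E → ℝ} {L : ℝ≥0} (hV : LipschitzWith L V)
    {u v : E → ℝ} (hu : WaveIterate D V u) (hv : WaveIterate D V v) :
    ∃ w, WaveIterate D V w ∧ (∀ e, w e ≤ u e) ∧ ∀ e, w e ≤ v e := by
  induction hv with
  | base => exact ⟨u, hu, fun _ => le_rfl, hu.le⟩
  | @step v a ha hv ih =>
    obtain ⟨w, hw, hwu, hwv⟩ := ih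
    exact ⟨waveStep a w, .step ha hw, fun e => (waveStep_le _ _ _).trans (hwu e),
      waveStep_mono (hw.lipschitz hV).continuous (hv.lipschitz hV).continuous hwv a⟩

theorem WaveIterate.rescale {D : Set E} (hD : ∀ a ∈ D, ∀ t : ℝ, t • a ∈ D) {V : E → ℝ}
    (hV : ∀ t : ℝ, 0 < t → ∀ e, V (t • e) = t * V e) {u : E → ℝ} (hu : WaveIterate D V u)
    {t : ℝ} (ht : 0 < t) : WaveIterate D V fun e => t * u (t⁻¹ • e) := by
  induction hu with
  | base =>
    have : (fun e => t * V (t⁻¹ • e)) = V := by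
      ext e; rw [← hV t ht, smul_inv_smul₀ ht.ne']
    rw [this]; exact .base
  | @step u a ha hu ih =>
    have : (fun e => t * waveStep a u (t⁻¹ • e)) =
        waveStep (t • a) (fun e => t * u (t⁻¹ • e)) := by
      ext e
      rw [waveStep, waveStep, mul_min_of_nonneg _ _ ht.le, waveMean, waveMean]
      have : ∀ θ, t⁻¹ • (e + Real.cos θ • t • a) = t⁻¹ • e + Real.cos θ • a := fun θ => by
        rw [smul_add, smul_comm _ t, inv_smul_smul₀ ht.ne']
      simp only [intervalIntegral.integral_const_mul, this]
      rw [mul_left_comm]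
    rw [this]
    exact .step (hD a ha t) ih

section

variable {D : Set E} {V : E → ℝ} {L : ℝ≥0}

theorem WaveIterate.lower_bound (hV : LipschitzWith L V)
    (h0 : ∀ u, WaveIterate D V u → 0 ≤ u 0) {u : E → ℝ} (hu : WaveIterate D V u) (e : E) :
    -(L * ‖e‖) ≤ u e := by
  have := (hu.lipschitz hV).le_add_mul 0 e
  rw [dist_zero_left] at this
  linarith [h0 u hu]

theorem bddBelow_waveIterate (hV : LipschitzWith L V)
    (h0 : ∀ u, WaveIterate D V u → 0 ≤ u 0) (e : E) :
    BddBelow (range fun u : {u : E → ℝ // WaveIterate D V u} => u.1 e) := by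
  refine ⟨-(L * ‖e‖), ?_⟩
  rintro _ ⟨u, rfl⟩
  exact u.2.lower_bound hV h0 e

theorem waveEnvelope_le (hV : LipschitzWith L V) (h0 : ∀ u, WaveIterate D V u → 0 ≤ u 0)
    {u : E → ℝ} (hu : WaveIterate D V u) (e : E) : waveEnvelope D V e ≤ u e :=
  ciInf_le (bddBelow_waveIterate hV h0 e) ⟨u, hu⟩

theorem le_waveEnvelope {c : ℝ} {e : E} (h : ∀ u, WaveIterate D V u → c ≤ u e) :
    c ≤ waveEnvelope D V e :=
  have : Nonempty {u : E → ℝ // WaveIterate D V u} := ⟨⟨V, .base⟩⟩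
  le_ciInf fun u => h u.1 u.2

theorem lipschitzWith_waveEnvelope (hV : LipschitzWith L V)
    (h0 : ∀ u, WaveIterate D V u → 0 ≤ u 0) : LipschitzWith L (waveEnvelope D V) := by
  refine LipschitzWith.of_le_add_mul L fun x y => ?_
  rw [← sub_le_iff_le_add]
  refine le_waveEnvelope fun u hu => ?_
  linarith [(hu.lipschitz hV).le_add_mul x y, waveEnvelope_le hV h0 hu x]

theorem exists_waveIterate_le_on_finset (hV : LipschitzWith L V)
    {ε : ℝ} (hε : 0 < ε) (s : Finset E) :
    ∃ u, WaveIterate D V u ∧ ∀ e ∈ s, u e ≤ waveEnvelope D V e + ε := by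
  classical
  induction s using Finset.induction_on with
  | empty => exact ⟨V, .base, by simp⟩
  | insert x s _ ih =>
    obtain ⟨u, hu, hus⟩ := ih
    have : Nonempty {u : E → ℝ // WaveIterate D V u} := ⟨⟨V, .base⟩⟩
    obtain ⟨⟨v, hv⟩, hvx⟩ := exists_lt_of_ciInf_lt (lt_add_of_pos_right (waveEnvelope D V x) hε)
    obtain ⟨w, hw, hwu, hwv⟩ := hu.exists_le_le hV hv
    refine ⟨w, hw, fun e he => ?_⟩
    rcases Finset.mem_insert.1 he with rfl | he
    · exact (hwv e).trans hvx.le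
    · exact (hwu e).trans (hus e he)

theorem exists_waveIterate_le_on_compact (hV : LipschitzWith L V)
    (h0 : ∀ u, WaveIterate D V u → 0 ≤ u 0) {ε : ℝ} (hε : 0 < ε) {K : Set E}
    (hK : IsCompact K) :
    ∃ u, WaveIterate D V u ∧ ∀ e ∈ K, u e ≤ waveEnvelope D V e + ε := by
  set δ : ℝ := ε / (3 * (L + 1)) with hδ
  have hδ0 : 0 < δ := by positivity
  obtain ⟨t, -, htf, hcov⟩ := hK.finite_cover_balls hδ0
  obtain ⟨u, hu, hut⟩ :=
    exists_waveIterate_le_on_finset (D := D) hV (by positivity : 0 < ε / 3) htf.toFinset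
  refine ⟨u, hu, fun e he => ?_⟩
  obtain ⟨x, hx, hex⟩ := mem_iUnion₂.1 (hcov he)
  have h1 := (hu.lipschitz hV).le_add_mul e x
  have h2 := (lipschitzWith_waveEnvelope hV h0).le_add_mul x e
  have h3 := hut x (htf.mem_toFinset.2 hx)
  rw [dist_comm] at h2
  have h4 : L * dist e x ≤ ε / 3 := by
    calc (L : ℝ) * dist e x ≤ (L + 1) * δ := by
          gcongr
          · linarith
          · exact (Metric.mem_ball.1 hex).le
      _ = ε / 3 := by rw [hδ]; field_simp
  linarith

/-- The envelope has the sub-mean value property: on the compact segment over which the mean is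
taken, a single function obtained from `V` is uniformly close to the envelope, and its next step
is still above the envelope. -/
theorem waveEnvelope_le_waveMean (hV : LipschitzWith L V)
    (h0 : ∀ u, WaveIterate D V u → 0 ≤ u 0) {a : E} (ha : a ∈ D) (e : E) :
    waveEnvelope D V e ≤ waveMean (waveEnvelope D V) a e := by
  refine le_of_forall_pos_le_add fun ε hε => ?_
  have hK : IsCompact ((fun r : ℝ => e + r • a) '' Icc (-1) 1) :=
    isCompact_Icc.image (by fun_prop)
  obtain ⟨u, hu, huK⟩ := exists_waveIterate_le_on_compact (D := D) hV h0 hε hK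
  have hc := (hu.lipschitz hV).continuous
  have hBc := (lipschitzWith_waveEnvelope hV h0).continuous
  rw [← waveMean_add_const hBc]
  refine (waveEnvelope_le hV h0 (.step ha hu) e).trans ((min_le_right _ _).trans ?_)
  refine mul_le_mul_of_nonneg_left ?_ (by positivity)
  refine intervalIntegral.integral_mono_on (by positivity)
    (Continuous.intervalIntegrable (by fun_prop) _ _)
    (Continuous.intervalIntegrable (by fun_prop) _ _) fun θ _ => huK _ ?_
  exact ⟨Real.cos θ, ⟨Real.neg_one_le_cos θ, Real.cos_le_one θ⟩, rfl⟩

/-- The envelope inherits the homogeneity of `V` because rescaling permutes the functions obtained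
from `V`, although a single step with a fixed direction does not preserve homogeneity. -/
theorem waveEnvelope_smul (hD : ∀ a ∈ D, ∀ t : ℝ, t • a ∈ D) (hV : LipschitzWith L V)
    (hVh : ∀ t : ℝ, 0 < t → ∀ e, V (t • e) = t * V e)
    (h0 : ∀ u, WaveIterate D V u → 0 ≤ u 0) {t : ℝ} (ht : 0 < t) (e : E) :
    waveEnvelope D V (t • e) = t * waveEnvelope D V e := by
  have key : ∀ {t : ℝ}, 0 < t → ∀ e, waveEnvelope D V (t • e) ≤ t * waveEnvelope D V e := by
    intro t ht e
    rw [← div_le_iff₀' ht]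
    refine le_waveEnvelope fun u hu => ?_
    rw [div_le_iff₀' ht]
    simpa [inv_smul_smul₀ ht.ne'] using waveEnvelope_le hV h0 (hu.rescale hD hVh ht) (t • e)
  refine le_antisymm (key ht e) ?_
  have := key (inv_pos.2 ht) (t • e)
  rw [inv_smul_smul₀ ht.ne'] at this
  rwa [← le_inv_mul_iff₀ ht]

theorem isHomogeneousConvexAlong_waveEnvelope (hD : ∀ a ∈ D, ∀ t : ℝ, t • a ∈ D)
    (hV : LipschitzWith L V) (hVh : ∀ t : ℝ, 0 < t → ∀ e, V (t • e) = t * V e)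
    (h0 : ∀ u, WaveIterate D V u → 0 ≤ u 0) :
    IsHomogeneousConvexAlong L D (waveEnvelope D V) where
  lipschitz := lipschitzWith_waveEnvelope hV h0
  map_smul _ ht e := waveEnvelope_smul hD hV hVh h0 ht e
  convex e v hv := by
    have hc := (lipschitzWith_waveEnvelope hV h0).continuous
    refine convexOn_of_le_circleMean (by fun_prop) fun x s => ?_
    refine (waveEnvelope_le_waveMean hV h0 (hD v hv s) (e + x • v)).trans_eq ?_
    simp only [waveMean, add_smul, mul_smul, add_assoc]

/-- If all functions obtained from a positively homogeneous `V` are nonnegative at the origin,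
then `V` has a nonnegative even part on the span of the directions. -/
theorem add_neg_nonneg_of_waveIterate (hD : ∀ a ∈ D, ∀ t : ℝ, t • a ∈ D)
    (hV : LipschitzWith L V) (hVh : ∀ t : ℝ, 0 < t → ∀ e, V (t • e) = t * V e)
    (h0 : ∀ u, WaveIterate D V u → 0 ≤ u 0) {e : E} (he : e ∈ Submodule.span ℝ D) :
    0 ≤ V e + V (-e) := by
  have := (isHomogeneousConvexAlong_waveEnvelope hD hV hVh h0).add_neg_nonneg he
  linarith [waveEnvelope_le hV h0 .base e, waveEnvelope_le hV h0 .base (-e)]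

end

end Envelope

/-! ### Iterated partial derivatives -/

section Derivatives

variable {𝕜 : Type*} [RCLike 𝕜] {d : ℕ}

theorem contDiff_partialDeriv {f : (Fin d → ℝ) → 𝕜} (hf : ContDiff ℝ ∞ f) (i : Fin d) :
    ContDiff ℝ ∞ (partialDeriv i f) :=
  (hf.fderiv_right (m := ∞) le_rfl).clm_apply contDiff_const

theorem support_partialDeriv_subset (f : (Fin d → ℝ) → 𝕜) (i : Fin d) :
    Function.support (partialDeriv i f) ⊆ tsupport f := by
  intro x hx
  refine support_fderiv_subset ℝ (f := f) fun h => hx ?_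
  simp [partialDeriv, h]

theorem tsupport_partialDeriv_subset (f : (Fin d → ℝ) → 𝕜) (i : Fin d) :
    tsupport (partialDeriv i f) ⊆ tsupport f :=
  closure_minimal (support_partialDeriv_subset f i) isClosed_closure

theorem hasCompactSupport_partialDeriv {f : (Fin d → ℝ) → 𝕜} (hf : HasCompactSupport f)
    (i : Fin d) : HasCompactSupport (partialDeriv i f) :=
  hf.of_isClosed_subset isClosed_closure (tsupport_partialDeriv_subset f i)

theorem partialDeriv_add {f g : (Fin d → ℝ) → 𝕜} (hf : ContDiff ℝ ∞ f) (hg : ContDiff ℝ ∞ g)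
    (i : Fin d) : partialDeriv i (f + g) = partialDeriv i f + partialDeriv i g := by
  ext x
  simp only [partialDeriv, Pi.add_apply]
  rw [fderiv_add (hf.differentiable (by simp)).differentiableAt
    (hg.differentiable (by simp)).differentiableAt]
  rfl

theorem multiDeriv_induction {p : ((Fin d → ℝ) → 𝕜) → Prop}
    (hp : ∀ i g, p g → p (partialDeriv i g)) {f : (Fin d → ℝ) → 𝕜} (hf : p f) (m : Fin d →₀ ℕ) :
    p (multiDeriv m f) := by
  have hit : ∀ i (k : ℕ) g, p g → p ((partialDeriv i)^[k] g) := by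
    intro i k
    induction k with
    | zero => exact fun g hg => hg
    | succ k ih => exact fun g hg => ih _ (hp i g hg)
  unfold multiDeriv
  induction List.finRange d with
  | nil => exact hf
  | cons i l ih => exact hit i _ _ ih

theorem contDiff_multiDeriv {f : (Fin d → ℝ) → 𝕜} (hf : ContDiff ℝ ∞ f) (m : Fin d →₀ ℕ) :
    ContDiff ℝ ∞ (multiDeriv m f) :=
  multiDeriv_induction (p := ContDiff ℝ ∞) (fun i _ hg => contDiff_partialDeriv hg i) hf m

theorem tsupport_multiDeriv_subset (f : (Fin d → ℝ) → 𝕜) (m : Fin d →₀ ℕ) :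
    tsupport (multiDeriv m f) ⊆ tsupport f :=
  multiDeriv_induction (p := fun g => tsupport g ⊆ tsupport f)
    (fun i g hg => (tsupport_partialDeriv_subset g i).trans hg) subset_rfl m

theorem hasCompactSupport_multiDeriv {f : (Fin d → ℝ) → 𝕜} (hf : HasCompactSupport f)
    (m : Fin d →₀ ℕ) : HasCompactSupport (multiDeriv m f) :=
  hf.of_isClosed_subset isClosed_closure (tsupport_multiDeriv_subset f m)

theorem multiDeriv_add {f g : (Fin d → ℝ) → 𝕜} (hf : ContDiff ℝ ∞ f) (hg : ContDiff ℝ ∞ g)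
    (m : Fin d →₀ ℕ) : multiDeriv m (f + g) = multiDeriv m f + multiDeriv m g := by
  have hit : ∀ i (k : ℕ) (f g : (Fin d → ℝ) → 𝕜), ContDiff ℝ ∞ f → ContDiff ℝ ∞ g →
      (partialDeriv i)^[k] (f + g) = (partialDeriv i)^[k] f + (partialDeriv i)^[k] g ∧
      ContDiff ℝ ∞ ((partialDeriv i)^[k] f) := by
    intro i k
    induction k with
    | zero => exact fun f g hf _ => ⟨rfl, hf⟩
    | succ k ih =>
      intro f g hf hg
      simp only [Function.iterate_succ_apply, partialDeriv_add hf hg]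
      exact ih _ _ (contDiff_partialDeriv hf i) (contDiff_partialDeriv hg i)
  have : ∀ l : List (Fin d),
      l.foldr (fun i g => (partialDeriv i)^[m i] g) (f + g) =
        l.foldr (fun i g => (partialDeriv i)^[m i] g) f +
          l.foldr (fun i g => (partialDeriv i)^[m i] g) g ∧
      ContDiff ℝ ∞ (l.foldr (fun i g => (partialDeriv i)^[m i] g) f) ∧
      ContDiff ℝ ∞ (l.foldr (fun i g => (partialDeriv i)^[m i] g) g) := by
    intro l
    induction l with
    | nil => exact ⟨rfl, hf, hg⟩
    | cons i l ih =>
      obtain ⟨h1, h2, h3⟩ := ih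
      simp only [List.foldr_cons, h1]
      exact ⟨(hit i _ _ _ h2 h3).1, (hit i _ _ _ h2 h3).2, (hit i _ _ _ h3 h2).2⟩
  exact (this _).1

end Derivatives

/-! ### Asymptotics of modulated plane waves -/

section Waves

variable {𝕜 : Type*} [RCLike 𝕜] {d : ℕ} {γ ξ : Fin d → ℝ}

/-- The modulated plane wave with amplitude `exp (q τ) ψ(x)`, frequency
`(exp (γ_i τ) ξ_i)_i` and phase `θ + φ`. The parameter `τ` is the logarithm of the anisotropic
dilation, so that `τ → ∞` is the limit of high frequencies. -/
noncomputable def modulatedWave (γ ξ : Fin d → ℝ) (q φ : ℝ) (ψ : (Fin d → ℝ) → 𝕜) (τ θ : ℝ)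
    (x : Fin d → ℝ) : 𝕜 :=
  (Real.exp (q * τ) * Real.cos ((∑ i, Real.exp (γ i * τ) * ξ i * x i) + θ + φ)) • ψ x

theorem contDiff_modulatedWave {ψ : (Fin d → ℝ) → 𝕜} (hψ : ContDiff ℝ ∞ ψ) (q φ τ θ : ℝ) :
    ContDiff ℝ ∞ (modulatedWave γ ξ q φ ψ τ θ) := by
  unfold modulatedWave
  refine ContDiff.smul (contDiff_const.mul (Real.contDiff_cos.comp ?_)) hψ
  refine (ContDiff.add (ContDiff.sum fun i _ => ?_) contDiff_const).add contDiff_const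
  exact contDiff_const.mul (contDiff_apply ℝ ℝ i)

theorem support_modulatedWave_subset (ψ : (Fin d → ℝ) → 𝕜) (q φ τ θ : ℝ) :
    Function.support (modulatedWave γ ξ q φ ψ τ θ) ⊆ Function.support ψ :=
  fun _ hx h => hx (by simp [modulatedWave, h])

theorem partialDeriv_modulatedWave {ψ : (Fin d → ℝ) → 𝕜} (hψ : ContDiff ℝ ∞ ψ) (q φ τ θ : ℝ)
    (i : Fin d) :
    partialDeriv i (modulatedWave γ ξ q φ ψ τ θ) =
      modulatedWave γ ξ (q + γ i) (φ + Real.pi / 2) (ξ i • ψ) τ θ +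
        modulatedWave γ ξ q φ (partialDeriv i ψ) τ θ := by
  ext x
  have hlin : HasFDerivAt (fun x : Fin d → ℝ => (∑ i, Real.exp (γ i * τ) * ξ i * x i) + θ + φ)
      (∑ i, (Real.exp (γ i * τ) * ξ i) •
        ContinuousLinearMap.proj (R := ℝ) (φ := fun _ : Fin d => ℝ) i) x := by
    refine HasFDerivAt.add_const _ (HasFDerivAt.add_const _ ?_)
    refine HasFDerivAt.fun_sum fun j _ => ?_
    exact (ContinuousLinearMap.proj (R := ℝ) (φ := fun _ : Fin d => ℝ) j).hasFDerivAt.const_mul _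
  have hψ' := (hψ.differentiable (by simp) x).hasFDerivAt
  have h := ((hlin.cos.const_mul (Real.exp (q * τ))).smul hψ')
  simp only [partialDeriv]
  have h2 : modulatedWave γ ξ q φ ψ τ θ = (fun x : Fin d → ℝ => Real.exp (q * τ) *
      Real.cos ((∑ i, Real.exp (γ i * τ) * ξ i * x i) + θ + φ)) • ψ := rfl
  have hs : ∑ j, Real.exp (γ j * τ) * ξ j * (Pi.single i (1 : ℝ) : Fin d → ℝ) j =
      Real.exp (γ i * τ) * ξ i := by
    rw [Finset.sum_eq_single i] <;> simp +contextual
  rw [h2, h.fderiv]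
  simp only [modulatedWave, Pi.add_apply, _root_.add_apply,
    _root_.smul_apply, ContinuousLinearMap.smulRight_apply,
    _root_.sum_apply, ContinuousLinearMap.proj_apply, smul_eq_mul, hs, Pi.smul_apply]
  rw [add_comm, ← add_assoc _ φ, Real.cos_add_pi_div_two, add_mul, Real.exp_add, smul_smul]
  congr 2
  ring

/-- Finite sums of modulated waves with amplitudes `exp (q τ)`, `q < p`. These expressions, unlike
bounds for them, are stable under differentiation. -/
inductive IsLowerOrder (γ ξ : Fin d → ℝ) (p : ℝ) : (ℝ → ℝ → (Fin d → ℝ) → 𝕜) → Prop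
  | wave {q : ℝ} (φ : ℝ) {ψ : (Fin d → ℝ) → 𝕜} (hq : q < p) (hψ : ContDiff ℝ ∞ ψ)
      (hc : HasCompactSupport ψ) : IsLowerOrder γ ξ p (modulatedWave γ ξ q φ ψ)
  | add {F G : ℝ → ℝ → (Fin d → ℝ) → 𝕜} (hF : IsLowerOrder γ ξ p F)
      (hG : IsLowerOrder γ ξ p G) : IsLowerOrder γ ξ p (F + G)

theorem IsLowerOrder.contDiff {p : ℝ} {F : ℝ → ℝ → (Fin d → ℝ) → 𝕜} (hF : IsLowerOrder γ ξ p F)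
    (τ θ : ℝ) : ContDiff ℝ ∞ (F τ θ) := by
  induction hF with
  | wave φ hq hψ hc => exact contDiff_modulatedWave hψ _ _ _ _
  | add _ _ h1 h2 => exact h1.add h2

theorem IsLowerOrder.partialDeriv {p : ℝ} {F : ℝ → ℝ → (Fin d → ℝ) → 𝕜}
    (hF : IsLowerOrder γ ξ p F) (hγ : ∀ i, 0 < γ i) (i : Fin d) :
    IsLowerOrder γ ξ (p + γ i) fun τ θ => partialDeriv i (F τ θ) := by
  induction hF with
  | @wave q φ ψ hq hψ hc =>
    have : (fun τ θ => Ornstein.partialDeriv i (modulatedWave γ ξ q φ ψ τ θ)) =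
        modulatedWave γ ξ (q + γ i) (φ + Real.pi / 2) (ξ i • ψ) +
        modulatedWave γ ξ q φ (Ornstein.partialDeriv i ψ) := by
      ext τ θ x; rw [partialDeriv_modulatedWave hψ]; rfl
    rw [this]
    refine .add (.wave _ (by linarith) (contDiff_const.smul hψ) ?_)
      (.wave _ (by linarith [hγ i]) (contDiff_partialDeriv hψ i)
        (hasCompactSupport_partialDeriv hc i))
    exact hc.mono (Function.support_const_smul_subset _ _)
  | @add F G hF hG h1 h2 =>
    have : (fun τ θ => Ornstein.partialDeriv i ((F + G) τ θ)) =
        (fun τ θ => Ornstein.partialDeriv i (F τ θ)) +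
          fun τ θ => Ornstein.partialDeriv i (G τ θ) := by
      ext τ θ x
      exact congrFun (partialDeriv_add (hF.contDiff τ θ) (hG.contDiff τ θ) i) x
    rw [this]
    exact .add h1 h2

theorem IsLowerOrder.eventually_norm_le {F : ℝ → ℝ → (Fin d → ℝ) → 𝕜}
    (hF : IsLowerOrder γ ξ 0 F) {ε : ℝ} (hε : 0 < ε) :
    ∀ᶠ τ in atTop, ∀ θ x, ‖F τ θ x‖ ≤ ε := by
  induction hF generalizing ε with
  | @wave q φ ψ hq hψ hc =>
    obtain ⟨C, hC⟩ := hc.exists_bound_of_continuous hψ.continuous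
    have hlim : Tendsto (fun τ => Real.exp (q * τ) * C) atTop (𝓝 (0 * C)) := by
      refine Tendsto.mul_const _ (Real.tendsto_exp_atBot.comp ?_)
      exact tendsto_id.const_mul_atTop_of_neg hq
    rw [zero_mul] at hlim
    filter_upwards [hlim.eventually (ge_mem_nhds hε)] with τ hτ θ x
    refine le_trans ?_ hτ
    rw [modulatedWave, norm_smul, norm_mul, Real.norm_eq_abs, Real.norm_eq_abs, Real.abs_exp]
    gcongr
    · exact mul_le_of_le_one_right (Real.exp_pos _).le (Real.abs_cos_le_one _)
    · exact hC x
  | add _ _ h1 h2 =>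
    filter_upwards [h1 (half_pos hε), h2 (half_pos hε)] with τ h1 h2 θ x
    exact (norm_add_le _ _).trans (by linarith [h1 θ x, h2 θ x])

/-- `F` is a wave of order `p` with phase shift `φ` and profile `c • ψ`, up to lower order. -/
def HasLeadingWave (γ ξ : Fin d → ℝ) (ψ : (Fin d → ℝ) → 𝕜) (p φ c : ℝ)
    (F : ℝ → ℝ → (Fin d → ℝ) → 𝕜) : Prop :=
  ∃ R, IsLowerOrder γ ξ p R ∧ F = modulatedWave γ ξ p φ (c • ψ) + R

theorem HasLeadingWave.partialDeriv {ψ : (Fin d → ℝ) → 𝕜} (hψ : ContDiff ℝ ∞ ψ)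
    (hc : HasCompactSupport ψ) (hγ : ∀ i, 0 < γ i) {p φ c : ℝ} {F : ℝ → ℝ → (Fin d → ℝ) → 𝕜}
    (hF : HasLeadingWave γ ξ ψ p φ c F) (i : Fin d) :
    HasLeadingWave γ ξ ψ (p + γ i) (φ + Real.pi / 2) (ξ i * c)
      fun τ θ => partialDeriv i (F τ θ) := by
  obtain ⟨R, hR, rfl⟩ := hF
  have hcψ : ContDiff ℝ ∞ (c • ψ) := contDiff_const.smul hψ
  refine ⟨modulatedWave γ ξ p φ (Ornstein.partialDeriv i (c • ψ)) +
    fun τ θ => Ornstein.partialDeriv i (R τ θ), .add (.wave _ (by linarith [hγ i])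
      (contDiff_partialDeriv hcψ i) (hasCompactSupport_partialDeriv ?_ i))
      (hR.partialDeriv hγ i), ?_⟩
  · exact hc.mono (Function.support_const_smul_subset _ _)
  · ext τ θ x
    have h1 := congrFun (partialDeriv_add (contDiff_modulatedWave (γ := γ) (ξ := ξ) hcψ p φ τ θ)
      (hR.contDiff τ θ) i) x
    rw [partialDeriv_modulatedWave hcψ, smul_smul] at h1
    refine h1.trans ?_
    simp only [Pi.add_apply, add_assoc]

theorem HasLeadingWave.multiDeriv {ψ : (Fin d → ℝ) → 𝕜} (hψ : ContDiff ℝ ∞ ψ)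
    (hc : HasCompactSupport ψ) (hγ : ∀ i, 0 < γ i) {p φ c : ℝ} {F : ℝ → ℝ → (Fin d → ℝ) → 𝕜}
    (hF : HasLeadingWave γ ξ ψ p φ c F) (m : Fin d →₀ ℕ) :
    HasLeadingWave γ ξ ψ (p + ∑ i, m i * γ i) (φ + m.degree * (Real.pi / 2))
      ((∏ i, ξ i ^ m i) * c) fun τ θ => multiDeriv m (F τ θ) := by
  have hit : ∀ i (k : ℕ) {p φ c : ℝ} {F : ℝ → ℝ → (Fin d → ℝ) → 𝕜},
      HasLeadingWave γ ξ ψ p φ c F →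
      HasLeadingWave γ ξ ψ (p + k * γ i) (φ + k * (Real.pi / 2)) (ξ i ^ k * c)
        fun τ θ => (Ornstein.partialDeriv i)^[k] (F τ θ) := by
    intro i k
    induction k with
    | zero => intro p φ c F hF; simpa using hF
    | succ k ih =>
      intro p φ c F hF
      have := ih (hF.partialDeriv hψ hc hγ i)
      simp only [Function.iterate_succ_apply]
      convert! this using 1 <;> push_cast <;> ring
  have hl : ∀ l : List (Fin d),
      HasLeadingWave γ ξ ψ (p + (l.map fun i => m i * γ i).sum)
        (φ + (l.map fun i => (m i : ℝ)).sum * (Real.pi / 2))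
        ((l.map fun i => ξ i ^ m i).prod * c)
        fun τ θ => l.foldr (fun i g => (Ornstein.partialDeriv i)^[m i] g) (F τ θ) := by
    intro l
    induction l with
    | nil => simpa using hF
    | cons i l ih =>
      have := hit i (m i) ih
      simp only [List.foldr_cons, List.map_cons, List.sum_cons, List.prod_cons]
      convert! this using 1 <;> ring
  have := hl (List.finRange d)
  rw [← Fin.sum_univ_def, ← Fin.sum_univ_def, ← Fin.prod_univ_def] at this
  rw [Finsupp.degree_eq_sum]
  push_cast
  exact this

/-- On the hyperplane with weights `γ`, the derivative `∂^m` of a wave of amplitude `exp (-τ)` is a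
wave of amplitude `1` up to lower order, and its phase is shifted by `|m| π / 2`. -/
theorem exists_multiDeriv_modulatedWave {ψ : (Fin d → ℝ) → 𝕜} (hψ : ContDiff ℝ ∞ ψ)
    (hc : HasCompactSupport ψ) (hγ : ∀ i, 0 < γ i) (m : Fin d →₀ ℕ)
    (hm : ∑ i, m i * γ i = 1) :
    ∃ R : ℝ → ℝ → (Fin d → ℝ) → 𝕜, IsLowerOrder γ ξ 0 R ∧ ∀ τ θ,
      multiDeriv m (modulatedWave γ ξ (-1) 0 ψ τ θ) =
        modulatedWave γ ξ 0 (m.degree * (Real.pi / 2)) ((∏ i, ξ i ^ m i) • ψ) τ θ + R τ θ := by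
  have h0 : HasLeadingWave γ ξ ψ (-1) 0 1 (modulatedWave γ ξ (-1) 0 ψ) := by
    refine ⟨modulatedWave γ ξ (-2) 0 0, .wave _ (by norm_num) contDiff_const
      HasCompactSupport.zero, ?_⟩
    ext τ θ x; simp [modulatedWave]
  obtain ⟨R, hR, h⟩ := h0.multiDeriv hψ hc hγ m
  rw [hm, neg_add_cancel] at hR
  refine ⟨R, hR, fun τ θ => ?_⟩
  rw [hm, neg_add_cancel, zero_add, mul_one] at h
  exact congrFun (congrFun h τ) θ

theorem cos_add_nat_mul_pi_div_two (t : ℝ) {k r : ℕ} (hk : k % 2 = r) :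
    Real.cos (t + k * (Real.pi / 2)) =
      (-1) ^ (k / 2) * Real.cos (t + r * (Real.pi / 2)) := by
  have : (k : ℝ) = r + 2 * (k / 2 : ℕ) := by
    have := Nat.mod_add_div k 2
    rw [hk] at this
    exact_mod_cast this.symm
  rw [this, ← Real.cos_add_nat_mul_pi]
  congr 1
  ring

end Waves

/-! ### Integral inequalities along jets -/

section Jets

variable {𝕜 : Type*} [RCLike 𝕜] {d : ℕ} (S : Finset (Fin d →₀ ℕ))

/-- The vector of the derivatives `∂^m f`, `m ∈ S`, at a point. -/
noncomputable def jet (f : (Fin d → ℝ) → 𝕜) (x : Fin d → ℝ) : S → 𝕜 :=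
  fun m => multiDeriv m.1 f x

variable (𝕜) in
/-- The direction in which the jet of a plane wave of frequency `ξ` oscillates. When all degrees
`|m|` have the same parity, the factors `i^{|m|}` have a common phase, and what is left of them
are the signs `(-1)^{⌊|m|/2⌋}`. -/
noncomputable def waveDirection (ξ : Fin d → ℝ) : S → 𝕜 :=
  fun m => (((-1) ^ (m.1.degree / 2) * ∏ i, ξ i ^ m.1 i : ℝ) : 𝕜)

variable (𝕜) in
/-- The multiples of all wave directions. -/
def waveCone : Set (S → 𝕜) := {a | ∃ (z : 𝕜) (ξ : Fin d → ℝ), a = z • waveDirection 𝕜 S ξ}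

/-- The integral of `u` along the jet of a test function is never negative. The integrals are over
bounded open sets that contain the support, so that they converge even if `u 0 ≠ 0`. -/
def IsNonnegOnJets (u : (S → 𝕜) → ℝ) : Prop :=
  ∀ (U : Set (Fin d → ℝ)), IsOpen U → Bornology.IsBounded U → ∀ f : (Fin d → ℝ) → 𝕜,
    ContDiff ℝ ∞ f → HasCompactSupport f → tsupport f ⊆ U → 0 ≤ ∫ x in U, u (jet S f x)

variable {S}

theorem continuous_jet {f : (Fin d → ℝ) → 𝕜} (hf : ContDiff ℝ ∞ f) : Continuous (jet S f) :=
  continuous_pi fun m => (contDiff_multiDeriv hf m.1).continuous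

theorem integrableOn_of_continuous {U : Set (Fin d → ℝ)} (hU : Bornology.IsBounded U)
    {g : (Fin d → ℝ) → ℝ} (hg : Continuous g) : IntegrableOn g U :=
  (hg.continuousOn.integrableOn_compact hU.isCompact_closure).mono_set subset_closure

theorem jet_zero (x : Fin d → ℝ) : jet S (0 : (Fin d → ℝ) → 𝕜) x = 0 := by
  ext m
  have : multiDeriv m.1 (0 : (Fin d → ℝ) → 𝕜) = 0 := by
    refine multiDeriv_induction (p := fun g => g = 0) ?_ rfl m.1
    rintro i _ rfl
    ext y
    simp [partialDeriv]
  exact congrFun this x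

theorem IsNonnegOnJets.zero_nonneg {u : (S → 𝕜) → ℝ} (hu : IsNonnegOnJets S u) : 0 ≤ u 0 := by
  have h := hu (Metric.ball 0 1) Metric.isOpen_ball Metric.isBounded_ball 0 contDiff_const
    HasCompactSupport.zero (by simp)
  simp only [jet_zero, setIntegral_const, smul_eq_mul] at h
  refine nonneg_of_mul_nonneg_right h ?_
  exact ENNReal.toReal_pos (Metric.measure_ball_pos _ _ one_pos).ne' measure_ball_lt_top.ne

/-- Oscillation in a wave direction can be added to the jet of `f` with an arbitrarily small
error, which is uniform in `x` and in the phase `θ`. -/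
theorem exists_jet_add_wave {γ : Fin d → ℝ} (hγ : ∀ i, 0 < γ i)
    (hS : ∀ m ∈ S, ∑ i, m i * γ i = 1) {r : ℕ} (hr : ∀ m ∈ S, m.degree % 2 = r)
    {f : (Fin d → ℝ) → 𝕜} (hf : ContDiff ℝ ∞ f) {χ : (Fin d → ℝ) → ℝ} (hχ : ContDiff ℝ ∞ χ)
    (hχc : HasCompactSupport χ) (z : 𝕜) (ξ : Fin d → ℝ) {ε : ℝ} (hε : 0 < ε) :
    ∃ (g : ℝ → (Fin d → ℝ) → 𝕜) (p : (Fin d → ℝ) → ℝ), Continuous p ∧ ∀ θ,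
      ContDiff ℝ ∞ (g θ) ∧ tsupport (g θ) ⊆ tsupport χ ∧
      ∀ x, ‖jet S (f + g θ) x -
        (jet S f x + Real.cos (p x + θ) • χ x • z • waveDirection 𝕜 S ξ)‖ ≤ ε := by
  set ψ : (Fin d → ℝ) → 𝕜 := fun x => χ x • z with hψ
  have hψs : Function.support ψ ⊆ Function.support χ := fun x hx h => hx (by simp [hψ, h])
  have hψd : ContDiff ℝ ∞ ψ := hχ.smul contDiff_const
  have hψc : HasCompactSupport ψ := hχc.mono hψs
  choose R hR hRe using fun m : S =>
    exists_multiDeriv_modulatedWave (ξ := ξ) hψd hψc hγ m.1 (hS m.1 m.2)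
  obtain ⟨τ, hτ⟩ := (eventually_all.2 fun m : S => (hR m).eventually_norm_le hε).exists
  refine ⟨modulatedWave γ ξ (-1) 0 ψ τ,
    fun x => (∑ i, Real.exp (γ i * τ) * ξ i * x i) + r * (Real.pi / 2), by fun_prop, fun θ =>
    ⟨contDiff_modulatedWave hψd _ _ _ _,
      closure_mono ((support_modulatedWave_subset _ _ _ _ _).trans hψs), fun x => ?_⟩⟩
  refine (pi_norm_le_iff_of_nonneg hε.le).2 fun m => ?_
  have h1 := congrFun (multiDeriv_add hf (contDiff_modulatedWave (γ := γ) (ξ := ξ)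
    hψd (-1) 0 τ θ) m.1) x
  have h2 : modulatedWave γ ξ 0 (m.1.degree * (Real.pi / 2)) ((∏ i, ξ i ^ m.1 i) • ψ) τ θ x =
      (Real.cos ((∑ i, Real.exp (γ i * τ) * ξ i * x i) + r * (Real.pi / 2) + θ) •
        χ x • z • waveDirection 𝕜 S ξ) m := by
    rw [modulatedWave, cos_add_nat_mul_pi_div_two _ (hr m.1 m.2), add_right_comm _ θ]
    simp only [hψ, Pi.smul_apply, waveDirection, zero_mul, Real.exp_zero, one_mul,
      RCLike.real_smul_eq_coe_mul, smul_eq_mul]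
    push_cast
    ring
  have h3 : (jet S (f + modulatedWave γ ξ (-1) 0 ψ τ θ) x - (jet S f x +
      Real.cos ((∑ i, Real.exp (γ i * τ) * ξ i * x i) + r * (Real.pi / 2) + θ) •
        χ x • z • waveDirection 𝕜 S ξ)) m = R m τ θ x := by
    rw [Pi.sub_apply, Pi.add_apply, ← h2]
    simp only [jet, h1, Pi.add_apply, hRe]
    ring
  rw [h3]
  exact hτ m θ x

theorem integral_cos_add_eq {E : Type*} [NormedAddCommGroup E] [NormedSpace ℝ E] (u : E → ℝ)
    (p : ℝ) (e a : E) :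
    ∫ θ in (0 : ℝ)..2 * Real.pi, u (e + Real.cos (p + θ) • a) =
      ∫ θ in (0 : ℝ)..2 * Real.pi, u (e + Real.cos θ • a) := by
  have hper : Function.Periodic (fun θ : ℝ => u (e + Real.cos θ • a)) (2 * Real.pi) :=
    fun θ => by simp only [Real.cos_add_two_pi]
  rw [intervalIntegral.integral_comp_add_left (fun θ => u (e + Real.cos θ • a)) p, add_zero,
    hper.intervalIntegral_add_eq p 0, zero_add]

theorem continuous_waveMean {E : Type*} [NormedAddCommGroup E] [NormedSpace ℝ E] {u : E → ℝ}
    {L : ℝ≥0} (hu : LipschitzWith L u) :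
    Continuous fun p : E × E => waveMean u p.1 p.2 := by
  refine (LipschitzWith.of_le_add_mul (2 * L) fun p q => ?_).continuous
  refine (waveMean_le_add hu p.1 q.1 p.2 q.2).trans ?_
  have h1 : ‖p.1 - q.1‖ ≤ dist p q := norm_fst_le (p - q) |>.trans_eq (dist_eq_norm p q).symm
  have h2 : ‖p.2 - q.2‖ ≤ dist p q := norm_snd_le (p - q) |>.trans_eq (dist_eq_norm p q).symm
  have : (L : ℝ) * (‖p.2 - q.2‖ + ‖p.1 - q.1‖) ≤ L * (2 * dist p q) := by
    gcongr; linarith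
  push_cast
  linarith

/-- The mean over the phase `θ` of the inequalities for the test functions `f + g θ`. -/
theorem IsNonnegOnJets.integral_waveMean_nonneg {γ : Fin d → ℝ} (hγ : ∀ i, 0 < γ i)
    (hS : ∀ m ∈ S, ∑ i, m i * γ i = 1) {r : ℕ} (hr : ∀ m ∈ S, m.degree % 2 = r)
    {u : (S → 𝕜) → ℝ} {L : ℝ≥0} (huL : LipschitzWith L u) (hu : IsNonnegOnJets S u)
    {U : Set (Fin d → ℝ)} (hU : IsOpen U) (hUb : Bornology.IsBounded U)
    {f : (Fin d → ℝ) → 𝕜} (hf : ContDiff ℝ ∞ f) (hfc : HasCompactSupport f)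
    (hfU : tsupport f ⊆ U) {χ : (Fin d → ℝ) → ℝ} (hχ : ContDiff ℝ ∞ χ)
    (hχc : HasCompactSupport χ) (hχU : tsupport χ ⊆ U) {a : S → 𝕜} (ha : a ∈ waveCone 𝕜 S) :
    0 ≤ ∫ x in U, waveMean u (χ x • a) (jet S f x) := by
  obtain ⟨z, ξ, rfl⟩ := ha
  set a := z • waveDirection 𝕜 S ξ
  have hpi : 0 < 2 * Real.pi := by positivity
  have huc := huL.continuous
  have hjc := continuous_jet (S := S) hf
  have hχcont := hχ.continuous
  set v : ℝ := volume.real U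
  have hv : 0 ≤ v := measureReal_nonneg
  have hfin : volume U < ⊤ := hUb.measure_lt_top
  have key : ∀ ε : ℝ, 0 < ε → 0 ≤ (∫ x in U, waveMean u (χ x • a) (jet S f x)) + L * ε * v := by
    intro ε hε
    obtain ⟨g, p, hp, hg⟩ := exists_jet_add_wave hγ hS hr hf hχ hχc z ξ hε
    -- By periodicity, the mean of `G θ x` over `θ` is a wave mean, whatever the phase `p x` is.
    set G : ℝ → (Fin d → ℝ) → ℝ := fun θ x => u (jet S f x + Real.cos (p x + θ) • χ x • a) with hG
    have hGc : Continuous (Function.uncurry G) := by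
      simp only [hG, Function.uncurry_def]; fun_prop
    have hGint : Integrable (Function.uncurry G)
        ((volume.restrict (Ioc 0 (2 * Real.pi))).prod (volume.restrict U)) := by
      rw [Measure.prod_restrict]
      refine IntegrableOn.mono_set ?_ (prod_mono Ioc_subset_Icc_self subset_closure)
      exact hGc.continuousOn.integrableOn_compact (isCompact_Icc.prod hUb.isCompact_closure)
    have hlow : ∀ θ, -(L * ε * v) ≤ ∫ x in U, G θ x := by
      intro θ
      obtain ⟨hgd, hgs, hgn⟩ := hg θ
      have hgc : HasCompactSupport (g θ) := hχc.of_isClosed_subset isClosed_closure hgs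
      have h1 := hu U hU hUb (f + g θ) (hf.add hgd) (hfc.add hgc)
        ((tsupport_add f (g θ)).trans (union_subset hfU (hgs.trans hχU)))
      have h2 : ∫ x in U, u (jet S (f + g θ) x) ≤ ∫ x in U, (G θ x + L * ε) := by
        have hGθ : Continuous (G θ) := by simp only [hG]; fun_prop
        refine setIntegral_mono
          (integrableOn_of_continuous hUb (huc.comp (continuous_jet (hf.add hgd))))
          (integrableOn_of_continuous hUb (by fun_prop)) fun x => ?_
        refine (huL.le_add_mul _ _).trans (add_le_add_right ?_ _)
        rw [dist_eq_norm]
        gcongr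
        exact hgn x
      rw [integral_add (integrableOn_of_continuous hUb (by simp only [hG]; fun_prop))
        (integrableOn_of_continuous hUb continuous_const), setIntegral_const, smul_eq_mul,
        mul_comm] at h2
      linarith
    have hswap : ∫ θ in Ioc 0 (2 * Real.pi), ∫ x in U, G θ x =
        (2 * Real.pi) * ∫ x in U, waveMean u (χ x • a) (jet S f x) := by
      rw [integral_integral_swap hGint, ← integral_const_mul]
      refine integral_congr_ae (Eventually.of_forall fun x => ?_)
      simp only [waveMean]
      rw [← mul_assoc, mul_inv_cancel₀ hpi.ne', one_mul, ← integral_cos_add_eq u (p x),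
        intervalIntegral.integral_of_le hpi.le]
    have hconst : ∫ _ in Ioc 0 (2 * Real.pi), -(L * ε * v) ≤
        ∫ θ in Ioc 0 (2 * Real.pi), ∫ x in U, G θ x :=
      integral_mono (integrable_const _) hGint.integral_prod_left hlow
    rw [hswap, setIntegral_const, Measure.real, Real.volume_Ioc, sub_zero,
      ENNReal.toReal_ofReal hpi.le, smul_eq_mul] at hconst
    have := le_of_mul_le_mul_left hconst hpi
    linarith
  refine le_of_forall_pos_le_add fun δ hδ => ?_
  have h := key (δ / (L * v + 1)) (by positivity)
  refine h.trans (add_le_add_right ?_ _)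
  rw [mul_right_comm, mul_div_assoc', div_le_iff₀ (by positivity)]
  nlinarith

theorem exists_smooth_tendsto_indicator {A : Set (Fin d → ℝ)} (hA : IsOpen A)
    (hAb : Bornology.IsBounded A) :
    ∃ χ : ℕ → (Fin d → ℝ) → ℝ, (∀ n, ContDiff ℝ ∞ (χ n) ∧ HasCompactSupport (χ n) ∧
      tsupport (χ n) ⊆ A ∧ ∀ x, |χ n x| ≤ 1) ∧
      (∀ x ∉ A, ∀ n, χ n x = 0) ∧ ∀ x ∈ A, ∀ᶠ n in atTop, χ n x = 1 := by
  obtain ⟨g, hgs, hgd, hg01⟩ := hA.exists_contDiff_support_eq (n := ⊤)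
  have hg0 : ∀ x, 0 ≤ g x := fun x => (hg01 (mem_range_self x)).1
  refine ⟨fun n x => Real.smoothTransition (n * g x - 1), fun n => ?_, fun x hx n => ?_,
    fun x hx => ?_⟩
  rotate_left
  · have : g x = 0 := by rwa [← hgs, Function.notMem_support] at hx
    simp [this, Real.smoothTransition.zero_of_nonpos]
  · have hpos : 0 < g x := lt_of_le_of_ne (hg0 x) (by rw [← hgs] at hx; exact Ne.symm hx)
    filter_upwards [(tendsto_natCast_atTop_atTop.atTop_mul_const hpos).eventually_ge_atTop 2]
      with k hk
    exact Real.smoothTransition.one_of_one_le (by linarith)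
  have hcl : IsClosed {x | 1 ≤ n * g x} :=
    isClosed_le continuous_const (continuous_const.mul hgd.continuous)
  have hts : tsupport (fun x => Real.smoothTransition (n * g x - 1)) ⊆ {x | 1 ≤ n * g x} := by
    refine closure_minimal (fun x hx => ?_) hcl
    by_contra hlt
    rw [mem_ofPred_eq, not_le] at hlt
    exact hx (Real.smoothTransition.zero_of_nonpos (by linarith))
  have hsub : {x | 1 ≤ n * g x} ⊆ A := by
    intro x hx
    rw [← hgs]
    intro h0
    rw [mem_ofPred_eq, h0, mul_zero] at hx
    linarith
  refine ⟨Real.smoothTransition.contDiff.comp ((contDiff_const.mul hgd).sub contDiff_const), ?_,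
    hts.trans hsub, fun x => ?_⟩
  · exact Metric.isCompact_of_isClosed_isBounded isClosed_closure (hAb.subset (hts.trans hsub))
  · rw [abs_of_nonneg (Real.smoothTransition.nonneg _)]
    exact Real.smoothTransition.le_one _

/-- The amplitude of the wave approximates the indicator function of the open set on which the
mean value is below `u`. -/
theorem IsNonnegOnJets.waveStep {γ : Fin d → ℝ} (hγ : ∀ i, 0 < γ i)
    (hS : ∀ m ∈ S, ∑ i, m i * γ i = 1) {r : ℕ} (hr : ∀ m ∈ S, m.degree % 2 = r)
    {u : (S → 𝕜) → ℝ} {L : ℝ≥0} (huL : LipschitzWith L u) (hu : IsNonnegOnJets S u)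
    {a : S → 𝕜} (ha : a ∈ waveCone 𝕜 S) : IsNonnegOnJets S (waveStep a u) := by
  intro U hU hUb f hf hfc hfU
  have huc := huL.continuous
  have hjc := continuous_jet (S := S) hf
  have hmc := continuous_waveMean huL
  have hmc' : Continuous (waveMean u a) := (lipschitzWith_waveMean huL a).continuous
  set A : Set (Fin d → ℝ) := U ∩ {x | waveMean u a (jet S f x) < u (jet S f x)} with hA
  have hAo : IsOpen A := hU.inter (isOpen_lt (hmc'.comp hjc) (huc.comp hjc))
  obtain ⟨χ, hχ, hχ0, hχ1⟩ := exists_smooth_tendsto_indicator hAo (hUb.subset inter_subset_left)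
  have hn : ∀ n, 0 ≤ ∫ x in U, waveMean u (χ n x • a) (jet S f x) := fun n =>
    hu.integral_waveMean_nonneg hγ hS hr huL hU hUb hf hfc hfU (hχ n).1 (hχ n).2.1
      ((hχ n).2.2.1.trans inter_subset_left) ha
  refine ge_of_tendsto' (x := atTop) ?_ hn
  refine tendsto_integral_of_dominated_convergence
    (fun x => |u (jet S f x)| + L * ‖a‖) (fun n => ?_) ?_ (fun n => ?_) ?_
  · have := (hχ n).1.continuous
    have hc : Continuous fun x => waveMean u (χ n x • a) (jet S f x) :=
      hmc.comp (Continuous.prodMk (by fun_prop) hjc)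
    exact hc.aestronglyMeasurable
  · exact integrableOn_of_continuous hUb (by fun_prop)
  · refine Eventually.of_forall fun x => ?_
    have hle : ‖χ n x • a‖ ≤ ‖a‖ := by
      rw [norm_smul]; exact mul_le_of_le_one_left (norm_nonneg _) ((hχ n).2.2.2 x)
    have h1 := waveMean_le_add huL (χ n x • a) 0 (jet S f x) (jet S f x)
    have h2 := waveMean_le_add huL 0 (χ n x • a) (jet S f x) (jet S f x)
    rw [waveMean_zero, sub_self, norm_zero, zero_add] at h1 h2
    rw [sub_zero] at h1
    rw [zero_sub, norm_neg] at h2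
    have h3 : (L : ℝ) * ‖χ n x • a‖ ≤ L * ‖a‖ := by gcongr
    rw [Real.norm_eq_abs, abs_le]
    constructor <;> linarith [neg_abs_le (u (jet S f x)), le_abs_self (u (jet S f x))]
  · refine (ae_restrict_iff' hU.measurableSet).2 (Eventually.of_forall fun x hx => ?_)
    refine tendsto_const_nhds.congr' ?_
    by_cases hxA : x ∈ A
    · filter_upwards [hχ1 x hxA] with n hn
      rw [hn, one_smul, Ornstein.waveStep, min_eq_right hxA.2.le]
    · refine Eventually.of_forall fun n => ?_
      have : u (jet S f x) ≤ waveMean u a (jet S f x) := not_lt.1 fun h => hxA ⟨hx, h⟩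
      simp only
      rw [hχ0 x hxA n, zero_smul, waveMean_zero, Ornstein.waveStep, min_eq_left this]

theorem IsNonnegOnJets.of_waveIterate {γ : Fin d → ℝ} (hγ : ∀ i, 0 < γ i)
    (hS : ∀ m ∈ S, ∑ i, m i * γ i = 1) {r : ℕ} (hr : ∀ m ∈ S, m.degree % 2 = r)
    {V : (S → 𝕜) → ℝ} {L : ℝ≥0} (hVL : LipschitzWith L V) (hV : IsNonnegOnJets S V)
    {u : (S → 𝕜) → ℝ} (hu : WaveIterate (waveCone 𝕜 S) V u) : IsNonnegOnJets S u := by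
  induction hu with
  | base => exact hV
  | step ha hu ih => exact ih.waveStep hγ hS hr (hu.lipschitz hVL) ha

theorem span_waveDirection : Submodule.span 𝕜 (range (waveDirection 𝕜 S)) = ⊤ := by
  classical
  by_contra hne
  obtain ⟨l, hl0, hl⟩ := Submodule.exists_le_ker_of_lt_top _ (lt_top_iff_ne_top.2 hne)
  -- a functional vanishing on all wave directions is a polynomial vanishing at all real points
  set P : MvPolynomial (Fin d) 𝕜 := ∑ m : S, MvPolynomial.monomial m.1
    (l (Pi.single m 1) * (-1) ^ (m.1.degree / 2)) with hP
  have hP0 : P = 0 := by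
    refine MvPolynomial.funext_set (fun _ => range ((↑) : ℝ → 𝕜))
      (fun _ => infinite_range_of_injective RCLike.ofReal_injective) fun x hx => ?_
    choose ξ hξ using fun i => hx i (mem_univ i)
    have h1 : l (waveDirection 𝕜 S ξ) = 0 := hl (Submodule.subset_span ⟨ξ, rfl⟩)
    rw [← Finset.univ_sum_single (waveDirection 𝕜 S ξ)] at h1
    rw [map_sum] at h1
    rw [map_zero, ← h1, hP, map_sum]
    refine Finset.sum_congr rfl fun m _ => ?_
    have h2 : (Pi.single m (waveDirection 𝕜 S ξ m) : S → 𝕜) =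
        waveDirection 𝕜 S ξ m • Pi.single m 1 := by
      rw [← Pi.single_smul, smul_eq_mul, mul_one]
    rw [h2, map_smul, MvPolynomial.eval_monomial,
      Finsupp.prod_fintype _ _ (by simp), waveDirection]
    push_cast
    simp only [hξ, smul_eq_mul]
    ring
  refine hl0 (LinearMap.pi_ext' fun m => LinearMap.ext_ring ?_)
  have h3 := congrArg (MvPolynomial.coeff m.1) hP0
  rw [hP, MvPolynomial.coeff_sum, Finset.sum_eq_single m] at h3
  · simpa using h3
  · intro b _ hb
    rw [MvPolynomial.coeff_monomial, if_neg fun h => hb (Subtype.ext h)]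
  · simp

theorem smul_mem_waveCone {a : S → 𝕜} (ha : a ∈ waveCone 𝕜 S) (t : ℝ) : t • a ∈ waveCone 𝕜 S := by
  obtain ⟨z, ξ, rfl⟩ := ha
  exact ⟨t • z, ξ, (smul_assoc t z (waveDirection 𝕜 S ξ)).symm⟩

theorem mem_span_waveCone (e : S → 𝕜) : e ∈ Submodule.span ℝ (waveCone 𝕜 S) := by
  have he : e ∈ Submodule.span 𝕜 (range (waveDirection 𝕜 S)) := by
    rw [span_waveDirection]; exact Submodule.mem_top
  obtain ⟨c, rfl⟩ := Finsupp.mem_span_range_iff_exists_finsupp.1 he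
  exact Submodule.sum_mem _ fun ξ _ => Submodule.subset_span ⟨c ξ, ξ, rfl⟩

/-- A Lipschitz positively homogeneous function of the jet whose integrals over jets of test
functions are nonnegative has a nonnegative even part. -/
theorem IsNonnegOnJets.add_neg_nonneg {γ : Fin d → ℝ} (hγ : ∀ i, 0 < γ i)
    (hS : ∀ m ∈ S, ∑ i, m i * γ i = 1) {r : ℕ} (hr : ∀ m ∈ S, m.degree % 2 = r)
    {V : (S → 𝕜) → ℝ} {L : ℝ≥0} (hVL : LipschitzWith L V)
    (hVh : ∀ t : ℝ, 0 < t → ∀ e, V (t • e) = t * V e) (hV : IsNonnegOnJets S V) (e : S → 𝕜) :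
    0 ≤ V e + V (-e) :=
  add_neg_nonneg_of_waveIterate (fun _ ha t => smul_mem_waveCone ha t) hVL hVh
    (fun _ hu => (hV.of_waveIterate hγ hS hr hVL hu).zero_nonneg) (mem_span_waveCone e)

end Jets

/-! ### Weights of a pattern of homogeneity -/

section Pattern

/-- A pattern of homogeneity that meets the semi-axes at `t i` is the hyperplane
`∑ i, p i / t i = 1`: its direction contains the kernel of this linear form, and both have
dimension `d - 1`. -/
theorem IsPatternOfHomogeneity.exists_weights {d : ℕ} {Λ : AffineSubspace ℝ (Fin d → ℝ)}
    (hΛ : IsPatternOfHomogeneity Λ) :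
    ∃ γ : Fin d → ℝ, (∀ i, 0 < γ i) ∧ ∀ p ∈ Λ, ∑ i, p i * γ i = 1 := by
  choose t ht htΛ using hΛ.meets_semiaxis
  have hd : 0 < d := by have := hΛ.hyperplane; omega
  set i₀ : Fin d := ⟨0, hd⟩
  set ℓ : (Fin d → ℝ) →ₗ[ℝ] ℝ := ∑ i, (t i)⁻¹ • LinearMap.proj i with hℓ
  have hℓa : ∀ x, ℓ x = ∑ i, x i * (t i)⁻¹ := fun x => by simp [hℓ, mul_comm]
  have hℓs : ∀ i, ℓ (Pi.single i (t i)) = 1 := fun i => by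
    rw [hℓa, Finset.sum_eq_single i] <;> simp +contextual [(ht i).ne']
  have hker : LinearMap.ker ℓ ≤ Λ.direction := by
    intro x hx
    rw [LinearMap.mem_ker, hℓa] at hx
    have hxs : x = ∑ i, (x i * (t i)⁻¹) • (Pi.single i (t i) - Pi.single i₀ (t i₀)) := by
      simp_rw [smul_sub]
      rw [Finset.sum_sub_distrib, ← Finset.sum_smul, hx, zero_smul, sub_zero]
      refine (Finset.univ_sum_single x).symm.trans (Finset.sum_congr rfl fun i _ => ?_)
      rw [← Pi.single_smul, smul_eq_mul, inv_mul_cancel_right₀ (ht i).ne']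
    rw [hxs]
    exact Submodule.sum_mem _ fun i _ => Submodule.smul_mem _ _
      (AffineSubspace.vsub_mem_direction (htΛ i) (htΛ i₀))
  have hrank : Module.finrank ℝ (LinearMap.ker ℓ) + 1 = d := by
    have h1 := ℓ.finrank_range_add_finrank_ker
    have h2 : LinearMap.range ℓ = ⊤ := LinearMap.range_eq_top.2 fun c =>
      ⟨c • Pi.single i₀ (t i₀), by rw [map_smul, hℓs]; simp⟩
    rw [h2, finrank_top, Module.finrank_self, Module.finrank_fin_fun] at h1
    omega
  have heq : LinearMap.ker ℓ = Λ.direction :=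
    Submodule.eq_of_le_of_finrank_eq hker (by have := hΛ.hyperplane; omega)
  refine ⟨fun i => (t i)⁻¹, fun i => inv_pos.2 (ht i), fun p hp => ?_⟩
  have h1 := AffineSubspace.vsub_mem_direction hp (htΛ i₀)
  rw [← heq, LinearMap.mem_ker, vsub_eq_sub, map_sub, hℓs, sub_eq_zero] at h1
  rw [← hℓa, h1]

end Pattern

/-! ### Differential operators as linear forms on jets -/

section Symbol

variable {𝕜 : Type*} [RCLike 𝕜] {d : ℕ} (S : Finset (Fin d →₀ ℕ))

/-- The linear form by which `P(∂)` acts on jets. -/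
noncomputable def coeffForm (P : MvPolynomial (Fin d) 𝕜) : (S → 𝕜) →L[𝕜] 𝕜 :=
  ∑ m : S, P.coeff m.1 • ContinuousLinearMap.proj (R := 𝕜) (φ := fun _ : S => 𝕜) m

variable {S}

theorem coeffForm_apply (P : MvPolynomial (Fin d) 𝕜) (e : S → 𝕜) :
    coeffForm S P e = ∑ m : S, P.coeff m.1 * e m := by
  simp [coeffForm]

theorem coeffForm_jet {P : MvPolynomial (Fin d) 𝕜} (hP : P.support ⊆ S) (f : (Fin d → ℝ) → 𝕜)
    (x : Fin d → ℝ) : coeffForm S P (jet S f x) = diffOp P f x := by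
  rw [coeffForm_apply, diffOp, Finset.sum_subset (f := fun m => P.coeff m * multiDeriv m f x) hP]
  · exact Finset.sum_coe_sort S (fun m => P.coeff m * multiDeriv m f x)
  · intro m _ hm
    rw [MvPolynomial.notMem_support_iff.1 hm, zero_mul]

theorem integrable_diffOp {P : MvPolynomial (Fin d) 𝕜} {f : (Fin d → ℝ) → 𝕜}
    (hf : ContDiff ℝ ∞ f) (hc : HasCompactSupport f) : Integrable (diffOp P f) := by
  unfold diffOp
  refine integrable_finsetSum _ fun m _ => Integrable.const_mul ?_ _
  exact (contDiff_multiDeriv hf m).continuous.integrable_of_hasCompactSupport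
    (hasCompactSupport_multiDeriv hc m)

theorem exists_lipschitzWith_norm_sub {n : ℕ} (C : ℝ) (ℓ : Fin (n + 1) → (S → 𝕜) →L[𝕜] 𝕜) :
    ∃ L, LipschitzWith L fun e => C * ∑ j : Fin n, ‖ℓ j.succ e‖ - ‖ℓ 0 e‖ := by
  have h1 : ∀ j, LipschitzWith ‖ℓ j‖₊ fun e => ‖ℓ j e‖ := fun j => by
    simpa using! lipschitzWith_one_norm.comp (ℓ j).lipschitz
  have h2 : ∀ s : Finset (Fin n), ∃ L, LipschitzWith L fun e => ∑ j ∈ s, ‖ℓ j.succ e‖ := by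
    classical
    intro s
    induction s using Finset.induction_on with
    | empty => exact ⟨0, by simp⟩
    | insert j s hj ih =>
      obtain ⟨L, hL⟩ := ih
      simp only [Finset.sum_insert hj]
      exact ⟨_, (h1 j.succ).add hL⟩
  obtain ⟨L, hL⟩ := h2 Finset.univ
  exact ⟨_, ((lipschitzWith_smul C).comp hL).sub (h1 0)⟩

theorem isNonnegOnJets_of_eLpNorm_le {n : ℕ} {T : Fin (n + 1) → MvPolynomial (Fin d) 𝕜}
    (hT : ∀ j, (T j).support ⊆ S) {C : ℝ≥0}
    (hC : ∀ f : (Fin d → ℝ) → 𝕜, ContDiff ℝ ∞ f → HasCompactSupport f →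
      eLpNorm (diffOp (T 0) f) 1 volume ≤
        C * ∑ j : Fin n, eLpNorm (diffOp (T j.succ) f) 1 volume) :
    IsNonnegOnJets S fun e : S → 𝕜 =>
      C * ∑ j : Fin n, ‖coeffForm S (T j.succ) e‖ - ‖coeffForm S (T 0) e‖ := by
  intro U hU _ f hf hfc hfU
  have hint : ∀ j, Integrable fun x => ‖diffOp (T j) f x‖ := fun j =>
    (integrable_diffOp hf hfc).norm
  have hnorm : ∀ j, eLpNorm (diffOp (T j) f) 1 volume =
      ENNReal.ofReal (∫ x, ‖diffOp (T j) f x‖) := fun j => by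
    rw [eLpNorm_one_eq_lintegral_enorm,
      ofReal_integral_norm_eq_lintegral_enorm (integrable_diffOp hf hfc)]
  have h := hC f hf hfc
  have hpos : ∀ j, 0 ≤ ∫ x, ‖diffOp (T j) f x‖ := fun j => integral_nonneg fun _ => norm_nonneg _
  simp only [hnorm] at h
  rw [← ENNReal.ofReal_sum_of_nonneg fun j _ => hpos j.succ, ← ENNReal.ofReal_coe_nnreal,
    ← ENNReal.ofReal_mul C.coe_nonneg, ENNReal.ofReal_le_ofReal_iff
      (mul_nonneg C.coe_nonneg (Finset.sum_nonneg fun j _ => hpos _))] at h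
  simp only [coeffForm_jet (hT _)]
  have hzero : ∀ x ∉ U, ∀ j, diffOp (T j) f x = 0 := by
    intro x hx j
    refine Finset.sum_eq_zero fun m _ => ?_
    rw [image_eq_zero_of_notMem_tsupport fun hm =>
      hx (hfU (tsupport_multiDeriv_subset f m hm)), mul_zero]
  rw [setIntegral_eq_integral_of_forall_compl_eq_zero fun x hx => by simp [hzero x hx],
    integral_sub ((integrable_finsetSum _ fun j _ => hint _).const_mul _) (hint 0),
    integral_const_mul, integral_finsetSum _ fun j _ => hint _]
  exact sub_nonneg.2 h

theorem mem_span_of_coeffForm {n : ℕ} {T : Fin (n + 1) → MvPolynomial (Fin d) 𝕜}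
    (hT : ∀ j, (T j).support ⊆ S)
    (h : ∀ e : S → 𝕜, (∀ j : Fin n, coeffForm S (T j.succ) e = 0) → coeffForm S (T 0) e = 0) :
    T 0 ∈ Submodule.span 𝕜 (range fun j : Fin n => T j.succ) := by
  classical
  have h1 : (coeffForm S (T 0) : (S → 𝕜) →ₗ[𝕜] 𝕜) ∈ Submodule.span 𝕜
      (range fun j : Fin n => (coeffForm S (T j.succ) : (S → 𝕜) →ₗ[𝕜] 𝕜)) := by
    refine mem_span_of_iInf_ker_le_ker fun e he => ?_
    simp only [Submodule.mem_iInf, LinearMap.mem_ker] at he ⊢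
    exact h e he
  obtain ⟨c, hc⟩ := (Submodule.mem_span_range_iff_exists_fun 𝕜).1 h1
  refine (Submodule.mem_span_range_iff_exists_fun 𝕜).2 ⟨c, ?_⟩
  ext m
  rw [MvPolynomial.coeff_sum]
  simp only [MvPolynomial.coeff_smul, smul_eq_mul]
  by_cases hm : m ∈ S
  · have h2 := LinearMap.congr_fun hc (Pi.single ⟨m, hm⟩ 1)
    have h3 : ∀ P : MvPolynomial (Fin d) 𝕜,
        coeffForm S P (Pi.single ⟨m, hm⟩ 1) = P.coeff m := fun P => by
      rw [coeffForm_apply, Finset.sum_eq_single ⟨m, hm⟩] <;> simp +contextual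
    simpa [LinearMap.sum_apply, h3] using h2
  · have h2 : ∀ j, (T j).coeff m = 0 := fun j =>
      MvPolynomial.notMem_support_iff.1 fun hj => hm (hT j hj)
    simp [h2]

end Symbol

end Ornstein

/-- The operators `T_1, …, T_ℓ` with `ℓ = n + 1` are `T 0, …, T n`, so that `T_1` is `T 0` and
`T_2, …, T_ℓ` are `T j.succ` for `j : Fin n`. -/
theorem mainTheorem1 {𝕜 : Type*} [RCLike 𝕜] {d n : ℕ}
    (Λ : AffineSubspace ℝ (Fin d → ℝ)) (hΛ : Ornstein.IsPatternOfHomogeneity Λ)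
    (T : Fin (n + 1) → MvPolynomial (Fin d) 𝕜)
    (hT : ∀ j, Ornstein.IsLambdaHomogeneous Λ (T j))
    (hparity : ∀ i j, ∀ a ∈ (T i).support, ∀ b ∈ (T j).support,
      a.degree ≡ b.degree [MOD 2])
    (hineq : ∃ C : ℝ≥0, ∀ f : (Fin d → ℝ) → 𝕜, ContDiff ℝ ∞ f → HasCompactSupport f →
      eLpNorm (Ornstein.diffOp (T 0) f) 1 volume ≤
        C * ∑ j : Fin n, eLpNorm (Ornstein.diffOp (T j.succ) f) 1 volume) :
    T 0 ∈ Submodule.span 𝕜 (Set.range fun j : Fin n => T j.succ) := by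
  classical
  obtain ⟨γ, hγ, hγΛ⟩ := hΛ.exists_weights
  obtain ⟨C, hC⟩ := hineq
  set S : Finset (Fin d →₀ ℕ) := Finset.univ.biUnion fun j => (T j).support with hS
  have hTS : ∀ j, (T j).support ⊆ S := fun j =>
    Finset.subset_biUnion_of_mem (fun j => (T j).support) (Finset.mem_univ j)
  have hSmem : ∀ m ∈ S, ∃ j, m ∈ (T j).support := fun m hm => by simpa [hS] using hm
  have hSγ : ∀ m ∈ S, ∑ i, m i * γ i = 1 := by
    intro m hm
    obtain ⟨j, hj⟩ := hSmem m hm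
    exact hγΛ _ (hT j ⟨m, hj, rfl⟩)
  obtain ⟨r, hr⟩ : ∃ r, ∀ m ∈ S, m.degree % 2 = r := by
    rcases S.eq_empty_or_nonempty with h | ⟨b, hb⟩
    · exact ⟨0, by simp [h]⟩
    · refine ⟨b.degree % 2, fun m hm => ?_⟩
      obtain ⟨i, hi⟩ := hSmem m hm
      obtain ⟨j, hj⟩ := hSmem b hb
      exact hparity i j m hi b hj
  obtain ⟨L, hL⟩ := Ornstein.exists_lipschitzWith_norm_sub (C : ℝ)
    fun j => Ornstein.coeffForm S (T j)
  refine Ornstein.mem_span_of_coeffForm hTS fun e he => ?_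
  have key := (Ornstein.isNonnegOnJets_of_eLpNorm_le hTS hC).add_neg_nonneg hγ hSγ hr hL ?_ e
  · simp only [map_neg, norm_neg, he, norm_zero, Finset.sum_const_zero, mul_zero] at key
    exact norm_eq_zero.1 (le_antisymm (by linarith) (norm_nonneg _))
  · intro t ht x
    have hsm : ∀ j, ‖Ornstein.coeffForm S (T j) (t • x)‖ =
        t * ‖Ornstein.coeffForm S (T j) x‖ := fun j => by
      rw [map_real_smul (Ornstein.coeffForm S (T j)) (Ornstein.coeffForm S (T j)).continuous,
        norm_smul, Real.norm_of_nonneg ht.le]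
    simp only [hsm, ← Finset.mul_sum]
    ring
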